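/- Let $\mathbb{D}=\{z\in\mathbb{C}:|z|<1\}$. For functions $g,h$ on $\mathbb{D}$, write $g\prec h$ if there is an analytic function $w$ on $\mathbb{D}$ with $w(0)=0$ and $|w(z)|\le|z|$ for all $z\in\mathbb{D}$ such that $g(z)=h(w(z))$ for all $z\in\mathbb{D}$. **Theorem.** Let $\gamma_1,\gamma_2,\gamma_3>0$, let $m,k$ be real constants with $k\ge m\ge 2$, and suppose that either $$\gamma_1-\gamma_2-m^2\gamma_3-3m(k-1)\gamma_3-e(e+1)\ \ge\ e\sinh 1$$ or $$1-e-e\bigl(\gamma_1+\gamma_2+m^2\gamma_3+3m(k-1)\gamma_3\bigr)\ \ge\ e\sinh 1 .$$ If $p$ is analytic in $\mathbb{D}$ with $p(0)=1$ and $$p(z)+\gamma_1 z p'(z)+\gamma_2 z^2p''(z)+\gamma_3 z^3p'''(z)\ \prec\ 1+\sin z ,$$ then $p(z)\prec e^z$. -/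

import Mathlib

/-- A Schwarz function: analytic on the open unit disk, vanishing at the origin,
with `|w z| ≤ |z|` on the disk. -/
structure IsSchwarzFunction (w : ℂ → ℂ) : Prop where
  differentiableOn : DifferentiableOn ℂ w (Metric.ball 0 1)
  map_zero : w 0 = 0
  norm_le : ∀ z ∈ Metric.ball (0 : ℂ) 1, ‖w z‖ ≤ ‖z‖

/-- Subordination `g ≺ h` on the open unit disk: `g = h ∘ w` there for some Schwarz function `w`.
Only the values of `g` and `h` on the disk matter. -/
def Subordinate (g h : ℂ → ℂ) : Prop :=
  ∃ w : ℂ → ℂ, IsSchwarzFunction w ∧ ∀ z ∈ Metric.ball (0 : ℂ) 1, g z = h (w z)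

/-! The second alternative never holds, as `1 - e < 0`; the first forces `γ₁ > e(e+1) > 9`. The
operator multiplies the `n`-th Taylor coefficient of `p` by a factor at least `9n`, and its image
minus `1` is `sin ∘ w`, of modulus at most `3`. Bessel (`sum_sq_norm_coeff_le`) and Cauchy–Schwarz
then keep `p` within `1/2` of `1`, so `log p` maps the disk into itself and the Schwarz lemma
applies. -/

open Finset in
/-- Bessel's inequality for the Taylor coefficients of a bounded power series. -/
theorem sum_sq_norm_coeff_le {a : ℕ → ℂ} {f : ℂ → ℂ} {M r : ℝ} (hr : 0 ≤ r)
    (hf : ∀ z : ℂ, ‖z‖ = r → HasSum (fun n => a n * z ^ n) (f z))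
    (hM : ∀ z : ℂ, ‖z‖ = r → ‖f z‖ ≤ M) (s : Finset ℕ) :
    ∑ n ∈ s, (‖a n‖ * r ^ n) ^ 2 ≤ M ^ 2 := by
  have : Fact ((0 : ℝ) < 1) := ⟨one_pos⟩
  have hrn : ‖(r : ℂ)‖ = r := by simp [abs_of_nonneg hr]
  have hM0 : 0 ≤ M := (norm_nonneg _).trans (hM r hrn)
  -- Absolute convergence at `z = r` makes the series converge uniformly on the whole circle.
  let u : ℕ → C(AddCircle (1 : ℝ), ℂ) := fun n => (a n * (r : ℂ) ^ n) • fourier (n : ℤ)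
  have hu : Summable u := by
    apply Summable.of_norm
    have := (hf r hrn).summable.norm
    simpa [u, norm_smul, fourier_norm] using this
  obtain ⟨F, hF⟩ := hu
  have hFM : ‖F‖ ≤ M := by
    rw [ContinuousMap.norm_le _ hM0]
    intro x
    have hx : ‖(r : ℂ) * AddCircle.toCircle x‖ = r := by
      rw [norm_mul, hrn, Circle.norm_coe, mul_one]
    have h1 := ContinuousMap.hasSum_apply hF x
    have h2 : F x = f ((r : ℂ) * AddCircle.toCircle x) := by
      refine h1.unique ?_
      convert! hf _ hx using 2 with n
      simp [u, fourier_apply, AddCircle.toCircle_nsmul, mul_pow, mul_assoc]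
    rw [h2]
    exact hM _ hx
  let T : C(AddCircle (1 : ℝ), ℂ) →L[ℂ] MeasureTheory.Lp ℂ 2 AddCircle.haarAddCircle :=
    ContinuousMap.toLp 2 AddCircle.haarAddCircle ℂ
  have hT : ‖T F‖ ≤ M := by
    have h1 : ‖T‖ ≤ 1 := by
      refine (ContinuousMap.toLp_norm_le _).trans ?_
      simp [MeasureTheory.measureUnivNNReal]
    calc ‖T F‖ ≤ ‖T‖ * ‖F‖ := T.le_opNorm F
      _ ≤ 1 * M := by gcongr
      _ = M := one_mul M
  have hcoef (n : ℕ) : inner ℂ (fourierLp (T := (1 : ℝ)) 2 (n : ℤ)) (T F) = a n * (r : ℂ) ^ n := by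
    have h1 := (hF.mapL T).mapL (innerSL ℂ (fourierLp (T := (1 : ℝ)) 2 (n : ℤ)))
    refine h1.unique ?_
    have h2 := hasSum_ite_eq n (a n * (r : ℂ) ^ n)
    convert! h2 using 2 with j
    have h3 := orthonormal_iff_ite.mp (orthonormal_fourier (T := (1 : ℝ))) n j
    simp only [u, map_smul, innerSL_apply_apply, smul_eq_mul]
    change _ * inner ℂ _ (fourierLp (T := (1 : ℝ)) 2 (j : ℤ)) = _
    rw [h3]
    by_cases h : j = n
    · simp [h]
    · simp [h, Ne.symm h]
  have hv : Orthonormal ℂ fun n : ℕ => fourierLp (T := (1 : ℝ)) 2 (n : ℤ) :=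
    orthonormal_fourier.comp _ Nat.cast_injective
  calc ∑ n ∈ s, (‖a n‖ * r ^ n) ^ 2
      = ∑ n ∈ s, ‖inner ℂ (fourierLp (T := (1 : ℝ)) 2 (n : ℤ)) (T F)‖ ^ 2 := by
        refine sum_congr rfl fun n _ => ?_
        rw [hcoef, norm_mul, norm_pow, hrn]
    _ ≤ ‖T F‖ ^ 2 := hv.sum_inner_products_le _
    _ ≤ M ^ 2 := by gcongr

/-- The power series of `z ^ j * f⁽ʲ⁾ z` is obtained by weighting that of `f` with falling
factorials. -/
theorem hasSum_pow_mul_iteratedDeriv {f : ℂ → ℂ} (hf : DifferentiableOn ℂ f (Metric.ball 0 1))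
    (j : ℕ) {z : ℂ} (hz : z ∈ Metric.ball (0 : ℂ) 1) :
    HasSum (fun n : ℕ => (n.descFactorial j : ℂ) * (iteratedDeriv n f 0 / n.factorial) * z ^ n)
      (z ^ j * iteratedDeriv j f z) := by
  have hd (j : ℕ) : DifferentiableOn ℂ (iteratedDeriv j f) (Metric.ball 0 1) := by
    induction j with
    | zero => simpa using hf
    | succ j ih => rw [iteratedDeriv_succ]; exact ih.deriv Metric.isOpen_ball
  have h := (Complex.hasSum_taylorSeries_on_ball (hd j) hz).mul_left (z ^ j)
  rw [← hasSum_nat_add_iff' j]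
  have h0 : ∑ n ∈ Finset.range j,
      (n.descFactorial j : ℂ) * (iteratedDeriv n f 0 / n.factorial) * z ^ n = 0 := by
    refine Finset.sum_eq_zero fun n hn => ?_
    simp [Nat.descFactorial_eq_zero_iff_lt.mpr (Finset.mem_range.mp hn)]
  rw [h0, sub_zero]
  convert! h using 2 with n
  have h1 : iteratedDeriv n (iteratedDeriv j f) 0 = iteratedDeriv (n + j) f 0 := by
    simp only [iteratedDeriv_eq_iterate, ← Function.iterate_add_apply]
  have h2 : ((n + j).factorial : ℂ) = n.factorial * (n + j).descFactorial j := by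
    have := Nat.factorial_mul_descFactorial (Nat.le_add_left j n)
    rw [Nat.add_sub_cancel] at this
    exact_mod_cast this.symm
  have h3 : (((n + j).descFactorial j : ℕ) : ℂ) ≠ 0 := by
    have : (n + j).descFactorial j ≠ 0 := by
      rw [Ne, Nat.descFactorial_eq_zero_iff_lt]; omega
    exact_mod_cast this
  have h4 : (n.factorial : ℂ) ≠ 0 := by exact_mod_cast n.factorial_ne_zero
  rw [h1, h2, smul_eq_mul, smul_eq_mul, sub_zero, pow_add]
  field_simp

theorem sum_range_inv_sq_le_two (N : ℕ) :
    ∑ n ∈ Finset.range N, (((n : ℝ) + 1)⁻¹) ^ 2 ≤ 2 := by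
  -- The sharper bound telescopes, so it survives induction.
  suffices h : ∀ N : ℕ, ∑ n ∈ Finset.range (N + 1), (((n : ℝ) + 1)⁻¹) ^ 2 ≤ 2 - 1 / ((N : ℝ) + 1) by
    refine (Finset.sum_le_sum_of_subset_of_nonneg (Finset.range_mono N.le_succ)
      fun _ _ _ => by positivity).trans ((h N).trans ?_)
    have : (0 : ℝ) ≤ 1 / ((N : ℝ) + 1) := by positivity
    linarith
  intro N
  induction N with
  | zero => norm_num
  | succ N ih =>
    rw [Finset.sum_range_succ]
    have h : (((N + 1 : ℕ) : ℝ) + 1)⁻¹ ^ 2 ≤ 1 / ((N : ℝ) + 1) - 1 / (((N + 1 : ℕ) : ℝ) + 1) := by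
      push_cast
      rw [div_sub_div _ _ (by positivity) (by positivity), inv_pow, inv_eq_one_div,
        div_le_div_iff₀ (by positivity) (by positivity)]
      have : (0 : ℝ) ≤ N := N.cast_nonneg
      nlinarith
    linarith

theorem norm_sin_le_three {w : ℂ} (hw : ‖w‖ ≤ 1) : ‖Complex.sin w‖ ≤ 3 := by
  have h (v : ℂ) (hv : ‖v‖ ≤ 1) : ‖Complex.exp v‖ ≤ 3 := by
    refine (Complex.norm_exp_le_exp_norm v).trans ?_
    have := Real.exp_one_lt_d9
    linarith [Real.exp_le_exp.mpr hv]
  rw [Complex.sin, norm_div, norm_mul, Complex.norm_I, mul_one, Complex.norm_ofNat]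
  have h1 := h (-w * Complex.I) (by simpa using hw)
  have h2 := h (w * Complex.I) (by simpa using hw)
  have h3 := norm_sub_le (Complex.exp (-w * Complex.I)) (Complex.exp (w * Complex.I))
  linarith

/-- If the third-order Euler operator applied to `p`, with nonnegative coefficients and first-order
coefficient at least `9`, stays within distance `3` of `p 0 = 1`, then `p` stays within distance
`1 / 2` of `1`. -/
theorem norm_sub_one_le_half {γ₁ γ₂ γ₃ : ℝ} (hγ₁ : 9 ≤ γ₁) (hγ₂ : 0 ≤ γ₂) (hγ₃ : 0 ≤ γ₃)
    {p : ℂ → ℂ} (hp : DifferentiableOn ℂ p (Metric.ball 0 1)) (hp0 : p 0 = 1)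
    (hbound : ∀ z ∈ Metric.ball (0 : ℂ) 1,
      ‖p z + γ₁ * z * deriv p z + γ₂ * z ^ 2 * iteratedDeriv 2 p z
        + γ₃ * z ^ 3 * iteratedDeriv 3 p z - 1‖ ≤ 3)
    {z : ℂ} (hz : z ∈ Metric.ball (0 : ℂ) 1) : ‖p z - 1‖ ≤ 1 / 2 := by
  set c : ℕ → ℂ := fun n => iteratedDeriv n p 0 / n.factorial with hc
  have hc0 : c 0 = 1 := by simp [hc, hp0]
  let P : ℕ → ℝ := fun n =>
    1 + γ₁ * n + γ₂ * n.descFactorial 2 + γ₃ * n.descFactorial 3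
  let g : ℂ → ℂ := fun z => p z + γ₁ * z * deriv p z + γ₂ * z ^ 2 * iteratedDeriv 2 p z
        + γ₃ * z ^ 3 * iteratedDeriv 3 p z - 1
  have hP (n : ℕ) : 9 * ((n : ℝ) + 1) ≤ P (n + 1) := by
    have h2 : 0 ≤ γ₂ * (n + 1).descFactorial 2 := by positivity
    have h3 : 0 ≤ γ₃ * (n + 1).descFactorial 3 := by positivity
    have h1 : 9 * ((n : ℝ) + 1) ≤ γ₁ * ((n : ℝ) + 1) := by gcongr
    simp only [P]
    push_cast
    linarith
  -- The constant term is `0`: subtracting `1` cancels `p 0`.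
  let a : ℕ → ℂ := fun n => if n = 0 then 0 else P n * c n
  have hps (v : ℂ) (hv : v ∈ Metric.ball (0 : ℂ) 1) : HasSum (fun n => c n * v ^ n) (p v) := by
    simpa using hasSum_pow_mul_iteratedDeriv hp 0 hv
  have hg (v : ℂ) (hv : v ∈ Metric.ball (0 : ℂ) 1) : HasSum (fun n => a n * v ^ n) (g v) := by
    have h1 := (hasSum_pow_mul_iteratedDeriv hp 1 hv).mul_left (γ₁ : ℂ)
    have h2 := (hasSum_pow_mul_iteratedDeriv hp 2 hv).mul_left (γ₂ : ℂ)
    have h3 := (hasSum_pow_mul_iteratedDeriv hp 3 hv).mul_left (γ₃ : ℂ)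
    have h := (((hps v hv).add h1).add h2).add h3 |>.sub (hasSum_ite_eq 0 (1 : ℂ))
    convert! h using 1
    · funext n
      rcases Nat.eq_zero_or_pos n with rfl | hn
      · simp [a, hc0]
      · simp only [a, P, hn.ne', if_false, Nat.descFactorial_one]
        push_cast
        ring
    · simp only [g, iteratedDeriv_one]
      ring
  have hr : ‖z‖ < 1 := by simpa using hz
  have hbessel := sum_sq_norm_coeff_le (norm_nonneg z)
    (fun v hv => hg v (by simpa [hv] using hr)) (fun v hv => hbound v (by simpa [hv] using hr))
  have hpz : HasSum (fun n => c (n + 1) * z ^ (n + 1)) (p z - 1) := by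
    have := (hasSum_nat_add_iff' 1).mpr (hps z hz)
    simpa [hc0] using this
  have hterm (n : ℕ) : ‖c (n + 1) * z ^ (n + 1)‖
      ≤ ‖a (n + 1)‖ * ‖z‖ ^ (n + 1) * (((n : ℝ) + 1)⁻¹ / 9) := by
    have h1 : (0 : ℝ) < (n : ℝ) + 1 := by positivity
    have h2 : ‖a (n + 1)‖ = P (n + 1) * ‖c (n + 1)‖ := by
      simp only [a, Nat.succ_ne_zero, if_false, norm_mul, Complex.norm_real, Real.norm_eq_abs]
      rw [abs_of_nonneg (le_trans (by positivity) (hP n))]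
    rw [h2, norm_mul, norm_pow]
    calc ‖c (n + 1)‖ * ‖z‖ ^ (n + 1)
        = (9 * ((n : ℝ) + 1)) * ‖c (n + 1)‖ * ‖z‖ ^ (n + 1) * (((n : ℝ) + 1)⁻¹ / 9) := by
          field_simp
      _ ≤ _ := by gcongr; exact hP n
  refine le_of_tendsto hpz.tendsto_sum_nat.norm (Filter.Eventually.of_forall fun N => ?_)
  have hsq : (∑ n ∈ Finset.range N, ‖a (n + 1)‖ * ‖z‖ ^ (n + 1) * (((n : ℝ) + 1)⁻¹ / 9)) ^ 2
      ≤ (1 / 2) ^ 2 := by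
    -- Cauchy–Schwarz gives `9 * (2 / 81) = 2 / 9 < 1 / 4`.
    refine (Finset.sum_mul_sq_le_sq_mul_sq _ _ _).trans ?_
    have h1 : ∑ n ∈ Finset.range N, (‖a (n + 1)‖ * ‖z‖ ^ (n + 1)) ^ 2 ≤ 3 ^ 2 := by
      have := hbessel ((Finset.range N).map (addRightEmbedding 1))
      simpa using this
    have h2 : ∑ n ∈ Finset.range N, (((n : ℝ) + 1)⁻¹ / 9) ^ 2 ≤ 2 / 81 := by
      simp only [div_pow, ← Finset.sum_div]
      have := sum_range_inv_sq_le_two N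
      norm_num at this ⊢
      linarith
    calc _ ≤ (3 : ℝ) ^ 2 * (2 / 81) := by
          gcongr
      _ ≤ _ := by norm_num
  exact (norm_sum_le_of_le _ fun n _ => hterm n).trans (abs_le_of_sq_le_sq' hsq (by norm_num)).2

/-- A function with value `1` at the origin and within distance `1 / 2` of `1` is subordinate to the
exponential: its logarithm is a Schwarz function. -/
theorem Subordinate.exp_of_norm_sub_one_le {p : ℂ → ℂ}
    (hp : DifferentiableOn ℂ p (Metric.ball 0 1)) (hp0 : p 0 = 1)
    (h : ∀ z ∈ Metric.ball (0 : ℂ) 1, ‖p z - 1‖ ≤ 1 / 2) : Subordinate p Complex.exp := by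
  have hslit : ∀ z ∈ Metric.ball (0 : ℂ) 1, p z ∈ Complex.slitPlane := fun z hz => by
    have := Complex.mem_slitPlane_of_norm_lt_one ((h z hz).trans_lt one_half_lt_one)
    simpa using this
  have hd : DifferentiableOn ℂ (fun z => Complex.log (p z)) (Metric.ball 0 1) := hp.clog hslit
  have h0 : Complex.log (p 0) = 0 := by simp [hp0]
  refine ⟨fun z => Complex.log (p z), ⟨hd, h0, fun z hz => ?_⟩, fun z hz =>
    (Complex.exp_log (Complex.slitPlane_ne_zero (hslit z hz))).symm⟩
  refine Complex.norm_le_norm_of_mapsTo_ball hd (fun v hv => ?_) h0 (by simpa using hz)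
  -- `|log (1 + u)| ≤ (3/2)|u| ≤ 3/4`, inside the unit disk.
  have h1 := Complex.norm_log_one_add_half_le_self (h v hv)
  rw [add_sub_cancel] at h1
  have h2 := h v hv
  rw [mem_closedBall_zero_iff]
  linarith

theorem theorem4p1 (γ₁ γ₂ γ₃ m k : ℝ) (hγ₁ : 0 < γ₁) (hγ₂ : 0 < γ₂) (hγ₃ : 0 < γ₃)
    (hm : 2 ≤ m) (hmk : m ≤ k)
    (hγ :
      Real.exp 1 * Real.sinh 1 ≤
          γ₁ - γ₂ - m ^ 2 * γ₃ - 3 * m * (k - 1) * γ₃ - Real.exp 1 * (Real.exp 1 + 1) ∨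
      Real.exp 1 * Real.sinh 1 ≤
          1 - Real.exp 1 - Real.exp 1 * (γ₁ + γ₂ + m ^ 2 * γ₃ + 3 * m * (k - 1) * γ₃))
    (p : ℂ → ℂ) (hp : DifferentiableOn ℂ p (Metric.ball 0 1)) (hp0 : p 0 = 1)
    (hsub : Subordinate
      (fun z => p z + (γ₁ : ℂ) * z * deriv p z + (γ₂ : ℂ) * z ^ 2 * iteratedDeriv 2 p z
        + (γ₃ : ℂ) * z ^ 3 * iteratedDeriv 3 p z)
      (fun z => 1 + Complex.sin z)) :
    Subordinate p Complex.exp := by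
  have he : 2.7 < Real.exp 1 := by have := Real.exp_one_gt_d9; linarith
  have hs : 0 < Real.sinh 1 := Real.sinh_pos_iff.mpr one_pos
  have hes : 0 < Real.exp 1 * Real.sinh 1 := by positivity
  have hm2 : 0 ≤ m ^ 2 * γ₃ := by positivity
  have hmk3 : 0 ≤ 3 * m * (k - 1) * γ₃ := by
    have h1 : 0 ≤ m := by linarith
    have h2 : 0 ≤ k - 1 := by linarith
    positivity
  have hγ9 : 9 ≤ γ₁ := by
    rcases hγ with h | h
    · nlinarith
    -- Contradictory case: the right side of `h` is negative.
    · have : 0 ≤ Real.exp 1 * (γ₁ + γ₂ + m ^ 2 * γ₃ + 3 * m * (k - 1) * γ₃) := by positivity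
      linarith
  obtain ⟨w, hw, hpw⟩ := hsub
  refine Subordinate.exp_of_norm_sub_one_le hp hp0 fun z hz =>
    norm_sub_one_le_half hγ9 hγ₂.le hγ₃.le hp hp0 (fun v hv => ?_) hz
  have hv' := hpw v hv
  beta_reduce at hv'
  rw [hv', add_sub_cancel_left]
  exact norm_sin_le_three ((hw.norm_le v hv).trans (mem_ball_zero_iff.mp hv).le)
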